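/- Let $[n]=\{1,\dots,n\}$. Consider a road net on the node set $[n]$ in which from each node there is at most one outgoing one-way street. Drivers $1,\dots,m$ arrive one after the other; driver $k$ starts at his preferred node $s_k\in[n]$ and follows the streets until he reaches the first node that is not occupied by an earlier driver, where he parks; he is unsuccessful if there is no such node. The sequence $s=(s_1,\dots,s_m)\in[n]^m$ is called a parking function for the road net if all $m$ drivers are successful. For a mapping $f:[n]\to[n]$ the streets lead from $i$ to $f(i)$, for every $i\in[n]$; for a rooted (unordered) labelled tree $T$ with node set $[n]$ the streets are the edges of $T$ oriented towards the root, and a driver who finds the root occupied leaves without parking. Let $M_{n,m}$ be the number of pairs $(f,s)$ with $f:[n]\to[n]$ and $s\in[n]^m$ a parking function for $f$, and let $F_{n,m}$ be the number of pairs $(T,s)$ with $T$ a rooted labelled tree with node set $[n]$ and $s\in[n]^m$ a parking function for $T$. Put $M_n=M_{n,n}$ and $F_n=F_{n,n}$. Theorem. For all $n\ge 1$, $$M_n = n!\,(n-1)!\,\sum_{j=0}^{n-1}\frac{(n-j)(2n)^j}{j!}\qquad\text{and}\qquad F_n = \big((n-1)!\big)^2\,\sum_{j=0}^{n-1}\frac{(n-j)(2n)^j}{j!}.$$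 -/

import Mathlib

namespace TreeParking

/-- The node reached after `t` steps from `v` in a road net in which a driver at node `v` moves on
to `next v`; the value `none` means that the driver has left the road net. -/
def travel {V : Type*} (next : V → Option V) : ℕ → V → Option V
  | 0, v => some v
  | t + 1, v => (next v).bind (travel next t)

/-- `π` is the output-function of the parking procedure with address sequence `s`, all drivers
being successful: driver `k` parks at the node `π k`, which is the first node on his way (starting
with `s k`) that has not been occupied by one of the previous drivers. -/
def IsOutput {V : Type*} {m : ℕ} (next : V → Option V) (s π : Fin m → V) : Prop :=
  ∀ k : Fin m, (∀ j < k, π j ≠ π k) ∧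
    ∃ t : ℕ, travel next t (s k) = some (π k) ∧
      ∀ i < t, ∀ w, travel next i (s k) = some w → ∃ j < k, π j = w

/-- `s` is a parking function for the road net: all drivers are able to park. -/
def IsParkingFunction {V : Type*} {m : ℕ} (next : V → Option V) (s : Fin m → V) : Prop :=
  ∃ π : Fin m → V, IsOutput next s π

/-- A rooted unordered tree with node set `V`; for `V = Fin n` these are the rooted labelled trees
(Cayley trees) of size `n`. -/
structure RootedLabelledTree (V : Type*) where
  /-- the underlying undirected graph -/
  graph : SimpleGraph V
  /-- the graph is a tree -/
  isTree : graph.IsTree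
  /-- the root node -/
  root : V

/-- The unique path from the node `v` to the root. -/
noncomputable def RootedLabelledTree.pathToRoot {V : Type*} (T : RootedLabelledTree V) (v : V) :
    T.graph.Walk v T.root :=
  (T.isTree.existsUnique_path v T.root).choose

open Classical in
/-- One step towards the root: from a node `v` other than the root a driver moves to the second
node on the path from `v` to the root, from the root he leaves the tree. -/
noncomputable def RootedLabelledTree.next {V : Type*} (T : RootedLabelledTree V) (v : V) :
    Option V :=
  if v = T.root then none else some (T.pathToRoot v).snd

/-- The number of pairs `(T, s)` with `T` a rooted labelled tree of size `n` and `s` a parking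
function for `T` with `m` drivers. -/
noncomputable def numTreeParking (n m : ℕ) : ℕ :=
  Nat.card {p : RootedLabelledTree (Fin n) × (Fin m → Fin n) // IsParkingFunction p.1.next p.2}

/-- The number of pairs `(f, s)` with `f` a map from an `n`-element set to itself and `s` a parking
function for `f` with `m` drivers. -/
noncomputable def numMappingParking (n m : ℕ) : ℕ :=
  Nat.card {p : (Fin n → Fin n) × (Fin m → Fin n) //
    IsParkingFunction (fun v => some (p.1 v)) p.2}

end TreeParking

/-! With as many drivers as nodes, the output-function is a permutation. Relabelling nodes by it
leaves the configurations in which driver `k` parks at node `k`, that is, his way to `k` passes only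
through smaller nodes; this costs a factor `n!` (`card_parking_eq`).

Such a configuration is cut at its last driver, the maximal node `v`. Let `B` be the set of other
nodes whose way leads to `v`. Cutting the streets into `v` leaves an acyclic configuration (a
forest) on `B` and an independent configuration on the remaining nodes. Driver `v` may start
anywhere in `B ∪ {v}`, and only the exit of `v` depends on the kind of net (`configCount_insert`).
This gives recurrences for forests, mappings and trees.

They are solved by Abel's identity `sum_abel_mul_abel`: `abel k x` is the coefficient of `t^k` in
`exp(xW)`, where `W = t exp(2W)`. Forest numbers weighted by size plus one have exponential
generating function `exp(2W)`, mappings have `1/(1 - W)`. Finally `n` times the tree number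
satisfies the mapping recurrence (`card_mul_configCount_tree`), so both formulas share one sum. -/

namespace TreeParking

/-! ### Abel polynomials and their convolution identity -/

open Polynomial in
/-- The Abel polynomial `x (x + 2 n) ^ (n - 1) / n!`, with value `1` for `n = 0`. -/
noncomputable def abelPoly : ℕ → ℚ[X]
  | 0 => 1
  | n + 1 => C (1 / ((n + 1).factorial : ℚ)) * (X * (X + C (2 * ((n : ℚ) + 1))) ^ n)

/-- The value of the Abel polynomial at `x`. -/
noncomputable def abel (n : ℕ) (x : ℚ) : ℚ := (abelPoly n).eval x

@[simp] theorem abel_zero (x : ℚ) : abel 0 x = 1 := by simp [abel, abelPoly]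

theorem abel_succ (n : ℕ) (x : ℚ) :
    abel (n + 1) x = x * (x + 2 * ((n : ℚ) + 1)) ^ n / ((n + 1).factorial : ℚ) := by
  simp [abel, abelPoly]; ring

@[simp] theorem abel_succ_zero (n : ℕ) : abel (n + 1) 0 = 0 := by simp [abel_succ]

/-- Writing the power with exponent `n - 1` as `c ^ n / c` treats `n = 0` uniformly and avoids
truncated subtraction. -/
theorem abel_of_add_eq {n : ℕ} {x c : ℚ} (hc : c ≠ 0) (h : x + 2 * n = c) :
    abel n x = x * c ^ n / (c * (n.factorial : ℚ)) := by
  cases n with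
  | zero =>
    have : x = c := by simpa using h
    subst this
    simp [hc]
  | succ n =>
    rw [abel_succ]
    have h' : x + 2 * ((n : ℚ) + 1) = c := by rw [← h]; push_cast; ring
    rw [h', pow_succ]
    field_simp

-- Differentiation lowers the index and shifts the argument by 2; together with the values at 0 this
-- determines the sequence, which is all the convolution identity needs.
open Polynomial in
theorem derivative_abelPoly_succ (n : ℕ) :
    derivative (abelPoly (n + 1)) = (abelPoly n).comp (X + C 2) := by
  apply Polynomial.funext
  intro x
  cases n with
  | zero => simp [abelPoly]
  | succ n =>
    have h : ((n + 1 + 1).factorial : ℚ) = ((n : ℚ) + 2) * ((n + 1).factorial : ℚ) := by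
      rw [Nat.factorial_succ]; push_cast; ring
    have h0 : ((n + 1).factorial : ℚ) ≠ 0 := by exact_mod_cast Nat.factorial_ne_zero _
    have h2 : (n : ℚ) + 2 ≠ 0 := by positivity
    simp only [abelPoly, derivative_mul, derivative_C, derivative_X, derivative_pow, h,
      eval_add, eval_mul, eval_C, eval_X, eval_pow, eval_comp, derivative_add, zero_mul, zero_add,
      one_mul, add_zero, mul_one, Nat.cast_add, Nat.cast_one, Nat.add_sub_cancel]
    rw [show x + 2 + 2 * ((n : ℚ) + 1) = x + 2 * ((n : ℚ) + 1 + 1) by ring, pow_succ]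
    field_simp
    ring

-- By induction the two sides have the same derivative. At 0 only the summand with `p.1 = 0`
-- survives, and there they agree.
open Polynomial Finset in
theorem sum_abelPoly_mul_C (n : ℕ) (y : ℚ) :
    ∑ p ∈ antidiagonal n, abelPoly p.1 * C (abel p.2 y) = (abelPoly n).comp (X + C y) := by
  induction n with
  | zero => simp [abelPoly]
  | succ n ih =>
    set D := ∑ p ∈ antidiagonal (n + 1), abelPoly p.1 * C (abel p.2 y) -
      (abelPoly (n + 1)).comp (X + C y) with hD
    have hd : derivative D = 0 := by
      rw [hD, derivative_sub, derivative_comp, derivative_abelPoly_succ,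
        Finset.Nat.antidiagonal_succ, sum_cons, derivative_add, sum_map, derivative_sum]
      have : ∀ p ∈ antidiagonal n, derivative (abelPoly (p.1 + 1) * C (abel p.2 y)) =
          (abelPoly p.1 * C (abel p.2 y)).comp (X + C 2) := by
        intro p _
        rw [derivative_mul, derivative_abelPoly_succ, mul_comp]
        simp
      have e := congrArg (fun q : ℚ[X] => q.comp (X + C 2)) ih
      simp only [Polynomial.sum_comp] at e
      simp only [Function.Embedding.prodMap, Function.Embedding.coeFn_mk, Prod.map,
        Nat.succ_eq_add_one, Function.Embedding.refl_apply]
      rw [sum_congr rfl this, e, comp_assoc, comp_assoc]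
      have : (X + C y : ℚ[X]).comp (X + C 2) = (X + C 2 : ℚ[X]).comp (X + C y) := by
        simp; ring
      rw [this]
      simp [abelPoly]
    have h0 : D.eval 0 = 0 := by
      rw [hD, Finset.Nat.antidiagonal_succ, sum_cons, sum_map, eval_sub, eval_add, eval_finsetSum]
      have : ∀ p ∈ antidiagonal n, eval 0 (abelPoly (p.1 + 1) * C (abel p.2 y)) = 0 := by
        intro p _; simp [abelPoly]
      simp only [Function.Embedding.prodMap, Function.Embedding.coeFn_mk, Prod.map,
        Nat.succ_eq_add_one, Function.Embedding.refl_apply]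
      rw [sum_congr rfl this]
      simp [abelPoly, abel]
    have hc := eq_C_of_natDegree_eq_zero (derivative_eq_zero.mp hd)
    have : D = 0 := by
      rw [hc, eval_C] at h0
      rw [hc, h0, C_0]
    exact sub_eq_zero.mp this

open Finset in
/-- Abel's convolution identity. -/
theorem sum_abel_mul_abel (n : ℕ) (x y : ℚ) :
    ∑ p ∈ antidiagonal n, abel p.1 x * abel p.2 y = abel n (x + y) := by
  have := congrArg (Polynomial.eval x) (sum_abelPoly_mul_C n y)
  simpa [abel, Polynomial.eval_finsetSum] using this

/-! ### Configurations, and cutting or gluing them at the last node -/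

/-- The way of a driver starting at `u` leads to `k`, and all nodes before `k` are smaller. -/
inductive ReachesBelow {V : Type*} [LT V] (f : V → Option V) : V → V → Prop
  | refl (k : V) : ReachesBelow f k k
  | step {u w k : V} : u < k → f u = some w → ReachesBelow f w k → ReachesBelow f u k

/-- No driver stays in the road net forever. -/
def IsAcyclicNet {V : Type*} (f : V → Option V) : Prop :=
  WellFounded fun w u => f u = some w

/-- All streets of the road net lead from nodes in `S` to nodes in `S`. -/
structure IsNetOn {V : Type*} (S : Finset V) (f : V → Option V) : Prop where
  eq_none : ∀ u ∉ S, f u = none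
  mem : ∀ u w, f u = some w → w ∈ S

theorem IsNetOn.mem_left {V : Type*} {S : Finset V} {f : V → Option V} (h : IsNetOn S f)
    {u w : V} (e : f u = some w) : u ∈ S := by
  by_contra hu
  simp [h.eq_none u hu] at e

section Decomposition

variable {V : Type*} [LinearOrder V]

/-- A road net on `S` together with an address sequence on `S` for which every driver `k ∈ S`
parks at the node `k`. -/
structure IsConfig (S : Finset V) (f : V → Option V) (s : V → V) : Prop extends IsNetOn S f where
  addr_eq : ∀ u ∉ S, s u = u
  reaches : ∀ k, ReachesBelow f (s k) k

theorem ReachesBelow.trans {f : V → Option V} {u k l : V} (h : ReachesBelow f u k)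
    (h' : ReachesBelow f k l) (hkl : k ≤ l) : ReachesBelow f u l := by
  induction h with
  | refl => exact h'
  | step huk e _ ih => exact .step (huk.trans_le hkl) e (ih h' hkl)

/-- The road net on `B`, with the exits leading to `v`, is joined with a second road net. -/
def glueNet (v : V) (B : Finset V) (x : Option V) (f₁ f₂ : V → Option V) (u : V) : Option V :=
  if u = v then x else if u ∈ B then some ((f₁ u).getD v) else f₂ u

/-- The address sequence for the joined road net. -/
def glueAddr (v : V) (B : Finset V) (y : V) (s₁ s₂ : V → V) (u : V) : V :=
  if u = v then y else if u ∈ B then s₁ u else s₂ u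

/-- The part of a road net below `v`. -/
def innerNet (v : V) (B : Finset V) (f : V → Option V) (u : V) : Option V :=
  if u ∈ B then (if f u = some v then none else f u) else none

/-- The restriction of a road net to `C`. -/
def restrictNet (C : Finset V) (f : V → Option V) (u : V) : Option V :=
  if u ∈ C then f u else none

/-- The restriction of an address sequence to `C`. -/
def restrictAddr (C : Finset V) (s : V → V) (u : V) : V :=
  if u ∈ C then s u else u

variable {v : V} {S B : Finset V}

@[simp] theorem glueNet_self (x : Option V) (f₁ f₂ : V → Option V) :
    glueNet v B x f₁ f₂ v = x := by simp [glueNet]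

theorem glueNet_of_mem (hv : ∀ u ∈ S, u < v) (hB : B ⊆ S) {u : V} (hu : u ∈ B) (x : Option V)
    (f₁ f₂ : V → Option V) : glueNet v B x f₁ f₂ u = some ((f₁ u).getD v) := by
  simp [glueNet, hu, (hv u (hB hu)).ne]

theorem glueNet_of_notMem {u : V} (hu : u ∉ B) (huv : u ≠ v) (x : Option V)
    (f₁ f₂ : V → Option V) : glueNet v B x f₁ f₂ u = f₂ u := by
  simp [glueNet, hu, huv]

/-- In an acyclic net every way ends at an exit, and gluing redirects all exits of `B` to `v`. -/
theorem glueNet_reaches_top (hv : ∀ u ∈ S, u < v) (hB : B ⊆ S) {f₁ f₂ : V → Option V}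
    (h₁ : IsNetOn B f₁) (ha : IsAcyclicNet f₁) (x : Option V) :
    ∀ u ∈ B, ReachesBelow (glueNet v B x f₁ f₂) u v := by
  intro u
  induction u using ha.induction with
  | _ u ih =>
    intro hu
    refine .step (hv u (hB hu)) (glueNet_of_mem hv hB hu _ _ _) ?_
    cases e : f₁ u with
    | none => exact .refl v
    | some w => exact ih w e (h₁.mem u w e)

theorem ReachesBelow.mem_of_glueNet (hv : ∀ u ∈ S, u < v) {x : Option V} {f₁ f₂ : V → Option V}
    (h₂ : IsNetOn (S \ B) f₂) {u : V} (h : ReachesBelow (glueNet v B x f₁ f₂) u v)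
    (hu : u ∈ S \ B) : False := by
  suffices H : ∀ k, ReachesBelow (glueNet v B x f₁ f₂) u k → u ∈ S \ B → k ≠ v from
    H v h hu rfl
  clear h hu
  intro k h
  induction h with
  | refl k => exact fun hk => (hv k (Finset.mem_sdiff.mp hk).1).ne
  | @step u w k huk e _ ih =>
    intro hu
    rw [glueNet_of_notMem (Finset.mem_sdiff.mp hu).2 (hv u (Finset.mem_sdiff.mp hu).1).ne] at e
    exact ih (h₂.mem _ _ e)

theorem isNetOn_glueNet (hB : B ⊆ S) {f₁ f₂ : V → Option V}
    (h₁ : IsNetOn B f₁) (h₂ : IsNetOn (S \ B) f₂) {x : Option V}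
    (hx : ∀ w, x = some w → w ∈ insert v S) : IsNetOn (insert v S) (glueNet v B x f₁ f₂) where
  eq_none u hu := by
    rw [Finset.mem_insert, not_or] at hu
    rw [glueNet_of_notMem (fun h => hu.2 (hB h)) hu.1]
    exact h₂.eq_none u (by simp [hu.2])
  mem u w e := by
    unfold glueNet at e
    split_ifs at e with h h'
    · exact hx w e
    · cases e₁ : f₁ u with
      | none => simp [e₁] at e; simp [e]
      | some w' =>
        simp [e₁] at e
        subst e
        exact Finset.mem_insert_of_mem (hB (h₁.mem _ _ e₁))
    · exact Finset.mem_insert_of_mem (Finset.mem_sdiff.mp (h₂.mem _ _ e)).1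

/-- Gluing preserves all existing streets, so old drivers keep their ways. Acyclicity of `f₁` serves
only the new driver `v`, who may start in `B`. -/
theorem isConfig_glue (hv : ∀ u ∈ S, u < v) (hB : B ⊆ S) {f₁ f₂ : V → Option V} {s₁ s₂ : V → V}
    (h₁ : IsConfig B f₁ s₁) (ha : IsAcyclicNet f₁) (h₂ : IsConfig (S \ B) f₂ s₂) {x : Option V}
    (hx : ∀ w, x = some w → w ∈ insert v S) {y : V} (hy : y ∈ insert v B) :
    IsConfig (insert v S) (glueNet v B x f₁ f₂) (glueAddr v B y s₁ s₂) where
  toIsNetOn := isNetOn_glueNet hB h₁.toIsNetOn h₂.toIsNetOn hx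
  addr_eq u hu := by
    rw [Finset.mem_insert, not_or] at hu
    have hu' : u ∉ B := fun h => hu.2 (hB h)
    simp only [glueAddr, hu.1, hu', if_false]
    exact h₂.addr_eq u (by simp [hu.2])
  reaches k := by
    unfold glueAddr
    split_ifs with hk hk'
    · subst hk
      rcases Finset.mem_insert.mp hy with rfl | hy
      · exact .refl _
      · exact glueNet_reaches_top hv hB h₁.toIsNetOn ha x y hy
    · have h := h₁.reaches k
      generalize s₁ k = u at h
      induction h with
      | refl k => exact .refl k
      | @step u w k huk e _ ih =>
        refine .step huk ?_ (ih hk hk')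
        rw [glueNet_of_mem hv hB (h₁.mem_left e), e, Option.getD_some]
    · have h := h₂.reaches k
      generalize s₂ k = u at h
      induction h with
      | refl k => exact .refl k
      | @step u w k huk e _ ih =>
        refine .step huk ?_ (ih hk hk')
        have hu := Finset.mem_sdiff.mp (h₂.mem_left e)
        rw [glueNet_of_notMem hu.2 (hv u hu.1).ne, e]

/-- `B` consists of the nodes of `S` below `v`. -/
def IsBasin (v : V) (S B : Finset V) (f : V → Option V) : Prop :=
  ∀ u, u ∈ B ↔ u ∈ S ∧ ReachesBelow f u v

theorem isBasin_glue (hv : ∀ u ∈ S, u < v) (hB : B ⊆ S) {f₁ f₂ : V → Option V}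
    (h₁ : IsNetOn B f₁) (ha : IsAcyclicNet f₁) (h₂ : IsNetOn (S \ B) f₂) (x : Option V) :
    IsBasin v S B (glueNet v B x f₁ f₂) := by
  intro u
  refine ⟨fun hu => ⟨hB hu, glueNet_reaches_top hv hB h₁ ha x u hu⟩, fun ⟨hu, h⟩ => ?_⟩
  by_contra hu'
  exact h.mem_of_glueNet hv h₂ (Finset.mem_sdiff.mpr ⟨hu, hu'⟩)

section Split

variable {f : V → Option V} {s : V → V}

theorem IsBasin.subset (hb : IsBasin v S B f) : B ⊆ S := fun u hu => ((hb u).mp hu).1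

theorem IsBasin.reaches_of_mem_insert (hb : IsBasin v S B f) {u : V} (hu : u ∈ insert v B) :
    ReachesBelow f u v := by
  rcases Finset.mem_insert.mp hu with rfl | hu
  · exact .refl _
  · exact ((hb u).mp hu).2

theorem IsBasin.exists_next (hv : ∀ u ∈ S, u < v) (hb : IsBasin v S B f)
    (hf : IsNetOn (insert v S) f) {u : V} (hu : u ∈ B) : ∃ w ∈ insert v B, f u = some w := by
  obtain ⟨huS, h⟩ := (hb u).mp hu
  cases h with
  | refl => exact absurd (hv _ huS) (lt_irrefl _)
  | @step _ w _ h e h' =>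
    refine ⟨w, ?_, e⟩
    rcases Finset.mem_insert.mp (hf.mem _ _ e) with rfl | hw
    · simp
    · exact Finset.mem_insert_of_mem ((hb w).mpr ⟨hw, h'⟩)

theorem IsBasin.next_mem_sdiff (hv : ∀ u ∈ S, u < v) (hb : IsBasin v S B f)
    (hf : IsNetOn (insert v S) f) {u w : V} (hu : u ∈ S \ B) (e : f u = some w) : w ∈ S \ B := by
  obtain ⟨huS, huB⟩ := Finset.mem_sdiff.mp hu
  have hw : w ∉ insert v B := fun hw =>
    huB ((hb u).mpr ⟨huS, .step (hv u huS) e (hb.reaches_of_mem_insert hw)⟩)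
  have := hf.mem _ _ e
  simp only [Finset.mem_insert, Finset.mem_sdiff, not_or] at *
  tauto

theorem isNetOn_innerNet (hv : ∀ u ∈ S, u < v) (hb : IsBasin v S B f)
    (hf : IsNetOn (insert v S) f) : IsNetOn B (innerNet v B f) where
  eq_none u hu := by simp [innerNet, hu]
  mem u w e := by
    unfold innerNet at e
    split_ifs at e with hu hfu
    obtain ⟨w', hw', e'⟩ := hb.exists_next hv hf hu
    rw [e'] at e hfu
    obtain rfl := Option.some.inj e
    rcases Finset.mem_insert.mp hw' with rfl | h
    · simp at hfu
    · exact h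

/-- Every node of `B` has a finite way to `v`; induction along it gives accessibility, since in the
inner net the way stops before `v`. -/
theorem isAcyclicNet_innerNet (hv : ∀ u ∈ S, u < v) (hb : IsBasin v S B f) : IsAcyclicNet (innerNet v B f) := by
  have key : ∀ u, ReachesBelow f u v → Acc (fun w u => innerNet v B f u = some w) u := by
    intro u h
    generalize hk : v = k at h
    induction h with
    | refl k =>
      subst hk
      constructor
      intro w hw
      have hvB : v ∉ B := fun h => (hv v (hb.subset h)).false
      simp [innerNet, hvB] at hw
    | @step u w k h e _ ih =>
      constructor
      intro w' hw
      unfold innerNet at hw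
      split_ifs at hw with h1 h2
      rw [e] at hw
      obtain rfl := Option.some.inj hw
      exact ih hk
  constructor
  intro u
  by_cases hu : u ∈ B
  · exact key u ((hb u).mp hu).2
  · constructor
    intro w hw
    simp [innerNet, hu] at hw

/-- The way of a driver `k ∈ B` can be prolonged from `k` to `v`, so it runs inside `B`; it avoids
`v` because its nodes are at most `k < v`. -/
theorem IsBasin.isConfig_inner (hv : ∀ u ∈ S, u < v) (hb : IsBasin v S B f)
    (hf : IsConfig (insert v S) f s) : IsConfig B (innerNet v B f) (restrictAddr B s) where
  toIsNetOn := isNetOn_innerNet hv hb hf.toIsNetOn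
  addr_eq u hu := by simp [restrictAddr, hu]
  reaches k := by
    unfold restrictAddr
    split_ifs with hk
    · have h := hf.reaches k
      generalize s k = u at h
      induction h with
      | refl k => exact .refl k
      | @step u w k huk e h ih =>
        have hwv := h.trans ((hb k).mp hk).2 (hv k (hb.subset hk)).le
        have hkv := hv k (hb.subset hk)
        have huS : u ∈ S := (Finset.mem_insert.mp (hf.mem_left e)).resolve_left
          (huk.trans hkv).ne
        have hu : u ∈ B := (hb u).mpr ⟨huS, .step (hv u huS) e hwv⟩
        refine .step huk ?_ (ih hk)
        have hw : w ≠ v := by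
          rintro rfl
          cases h with
          | refl => exact hkv.false
          | step h => exact (h.trans hkv).false
        simp [innerNet, hu, e, hw]
    · exact .refl k

/-- Streets from `B` end in `B ∪ {v}`, and a way to some `k < v` cannot use `v`; hence a way ending
outside `B` never meets `B`. -/
theorem IsBasin.mem_sdiff_of_reaches (hv : ∀ u ∈ S, u < v) (hb : IsBasin v S B f)
    (hf : IsNetOn (insert v S) f) {u k : V} (h : ReachesBelow f u k) (hk : k ∈ S \ B) :
    u ∈ S \ B := by
  have hkS := Finset.mem_sdiff.mp hk
  induction h with
  | refl k => exact hk
  | @step u w k huk e h ih =>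
    have hw := ih hk hkS
    have huS : u ∈ S := (Finset.mem_insert.mp (hf.mem_left e)).resolve_left
      (huk.trans (hv k hkS.1)).ne
    refine Finset.mem_sdiff.mpr ⟨huS, fun hu => ?_⟩
    obtain ⟨w', hw', e'⟩ := hb.exists_next hv hf hu
    obtain rfl : w = w' := Option.some.inj (e.symm.trans e')
    obtain ⟨hwS, hwB⟩ := Finset.mem_sdiff.mp hw
    rcases Finset.mem_insert.mp hw' with rfl | h'
    · exact (hv _ hwS).false
    · exact hwB h'

theorem IsBasin.isConfig_outer (hv : ∀ u ∈ S, u < v) (hb : IsBasin v S B f)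
    (hf : IsConfig (insert v S) f s) :
    IsConfig (S \ B) (restrictNet (S \ B) f) (restrictAddr (S \ B) s) where
  eq_none u hu := by simp only [restrictNet, hu, if_false]
  mem u w e := by
    unfold restrictNet at e
    split_ifs at e with hu
    exact hb.next_mem_sdiff hv hf.toIsNetOn hu e
  addr_eq u hu := by simp only [restrictAddr, hu, if_false]
  reaches k := by
    unfold restrictAddr
    split_ifs with hk
    · have h := hf.reaches k
      generalize s k = u at h
      induction h with
      | refl k => exact .refl k
      | @step u w k huk e h ih =>
        refine .step huk ?_ (ih hk)
        have hu := hb.mem_sdiff_of_reaches hv hf.toIsNetOn (.step huk e h) hk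
        simp only [restrictNet, hu, if_true, e]
    · exact .refl k

theorem IsBasin.addr_mem (hb : IsBasin v S B f) (hf : IsConfig (insert v S) f s) :
    s v ∈ insert v B := by
  have h := hf.reaches v
  by_cases hs : s v = v
  · simp [hs]
  · refine Finset.mem_insert_of_mem ((hb _).mpr ⟨?_, h⟩)
    generalize s v = u at h hs
    cases h with
    | refl => exact absurd rfl hs
    | step _ e _ => exact (Finset.mem_insert.mp (hf.mem_left e)).resolve_left hs

theorem IsBasin.glueNet_split (hv : ∀ u ∈ S, u < v) (hb : IsBasin v S B f)
    (hf : IsNetOn (insert v S) f) :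
    glueNet v B (f v) (innerNet v B f) (restrictNet (S \ B) f) = f := by
  funext u
  unfold glueNet
  split_ifs with h h'
  · rw [h]
  · obtain ⟨w, hw, e⟩ := hb.exists_next hv hf h'
    by_cases hwv : w = v <;> simp [innerNet, h', e, hwv]
  · by_cases hu : u ∈ S
    · simp [restrictNet, hu, h']
    · simp [restrictNet, hu, hf.eq_none u (by simp [h, hu])]

theorem glueAddr_split (hf : IsConfig (insert v S) f s) :
    glueAddr v B (s v) (restrictAddr B s) (restrictAddr (S \ B) s) = s := by
  funext u
  unfold glueAddr
  split_ifs with h h'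
  · rw [h]
  · simp [restrictAddr, h']
  · by_cases hu : u ∈ S
    · simp [restrictAddr, hu, h']
    · simp [restrictAddr, hu, hf.addr_eq u (by simp [h, hu])]

end Split

theorem innerNet_glueNet (hv : ∀ u ∈ S, u < v) (hB : B ⊆ S) {f₁ : V → Option V}
    (h₁ : IsNetOn B f₁) (x : Option V) (f₂ : V → Option V) :
    innerNet v B (glueNet v B x f₁ f₂) = f₁ := by
  funext u
  unfold innerNet
  split_ifs with h h'
  · rw [glueNet_of_mem hv hB h] at h'
    cases e : f₁ u with
    | none => rfl
    | some w =>
      rw [e, Option.getD_some] at h'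
      obtain rfl := Option.some.inj h'
      exact absurd (hv _ (hB (h₁.mem _ _ e))) (lt_irrefl _)
  · rw [glueNet_of_mem hv hB h] at h' ⊢
    cases e : f₁ u with
    | none => simp [e] at h'
    | some w => rfl
  · exact (h₁.eq_none u h).symm

theorem restrictNet_glueNet (hv : ∀ u ∈ S, u < v) {f₂ : V → Option V}
    (h₂ : IsNetOn (S \ B) f₂) (x : Option V) (f₁ : V → Option V) :
    restrictNet (S \ B) (glueNet v B x f₁ f₂) = f₂ := by
  funext u
  unfold restrictNet
  split_ifs with h
  · have h' := Finset.mem_sdiff.mp h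
    rw [glueNet_of_notMem h'.2 (hv u h'.1).ne]
  · exact (h₂.eq_none u h).symm

theorem restrictAddr_glueAddr_inner (hv : ∀ u ∈ S, u < v) (hB : B ⊆ S) {f₁ : V → Option V}
    {s₁ : V → V} (h₁ : IsConfig B f₁ s₁) (y : V) (s₂ : V → V) :
    restrictAddr B (glueAddr v B y s₁ s₂) = s₁ := by
  funext u
  unfold restrictAddr
  split_ifs with h
  · simp [glueAddr, h, (hv u (hB h)).ne]
  · exact (h₁.addr_eq u h).symm

theorem restrictAddr_glueAddr_outer (hv : ∀ u ∈ S, u < v) {f₂ : V → Option V}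
    {s₂ : V → V} (h₂ : IsConfig (S \ B) f₂ s₂) (y : V) (s₁ : V → V) :
    restrictAddr (S \ B) (glueAddr v B y s₁ s₂) = s₂ := by
  funext u
  unfold restrictAddr
  split_ifs with h
  · have h' := Finset.mem_sdiff.mp h
    simp [glueAddr, h'.2, (hv u h'.1).ne]
  · exact (h₂.addr_eq u h).symm

/-! ### The bijection behind the recurrences -/

section Count

open Classical in
/-- The number of configurations on `S` whose road net has the property `Q`. -/
noncomputable def configCount [Fintype V] (S : Finset V) (Q : (V → Option V) → Prop) : ℕ :=
  (Finset.univ.filter fun p : (V → Option V) × (V → V) => IsConfig S p.1 p.2 ∧ Q p.1).card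

-- Cutting and gluing at `v` are mutually inverse. The hypothesis `hQ` says that, once the part on
-- `B` is acyclic, `Q` depends only on the exit `x` of `v` and on the outer net.
open Classical in
theorem configCount_insert [Fintype V] (hv : ∀ u ∈ S, u < v)
    (Q : (V → Option V) → Prop) (R : Finset V → Option V → (V → Option V) → Prop)
    (hQ : ∀ B ⊆ S, ∀ f₁ f₂ x, IsNetOn B f₁ → IsAcyclicNet f₁ → IsNetOn (S \ B) f₂ →
      (∀ w, x = some w → w ∈ insert v S) → (Q (glueNet v B x f₁ f₂) ↔ R (S \ B) x f₂)) :
    configCount (insert v S) Q = ∑ B ∈ S.powerset, configCount B IsAcyclicNet * (B.card + 1) *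
      (Finset.univ.filter fun q : Option V × ((V → Option V) × (V → V)) =>
        (∀ w, q.1 = some w → w ∈ insert v S) ∧ R (S \ B) q.1 q.2.1 ∧
          IsConfig (S \ B) q.2.1 q.2.2).card := by
  unfold configCount
  -- The configurations are sorted by the basin of `v`.
  rw [Finset.card_eq_sum_card_fiberwise (t := S.powerset)
    (f := fun p => S.filter fun u => ReachesBelow p.1 u v)]
  swap
  · intro p _
    simp only [Finset.coe_powerset, Set.mem_preimage, Set.mem_powerset_iff, Finset.coe_subset]
    exact Finset.filter_subset _ _
  refine Finset.sum_congr rfl fun B hB => ?_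
  rw [Finset.mem_powerset] at hB
  have hvB : v ∉ B := fun h => (hv v (hB h)).false
  -- The factor `B.card + 1` counts the addresses of driver `v`, which range over `insert v B`.
  rw [← Finset.card_insert_of_notMem hvB, ← Finset.card_product, ← Finset.card_product]
  have hbas : ∀ f : V → Option V,
      (S.filter fun u => ReachesBelow f u v) = B ↔ IsBasin v S B f := by
    intro f
    simp only [Finset.ext_iff, Finset.mem_filter, IsBasin]
    exact forall_congr' fun u => Iff.comm
  refine Finset.card_nbij'
    (fun p => (((innerNet v B p.1, restrictAddr B p.2), p.2 v),
      (p.1 v, (restrictNet (S \ B) p.1, restrictAddr (S \ B) p.2))))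
    (fun q => (glueNet v B q.2.1 q.1.1.1 q.2.2.1, glueAddr v B q.1.2 q.1.1.2 q.2.2.2)) ?_ ?_ ?_ ?_
  · rintro ⟨f, s⟩ h
    simp only [Finset.coe_filter, Finset.mem_filter, Finset.mem_univ, true_and, hbas,
      Set.mem_ofPred_eq] at h
    obtain ⟨⟨hc, hq⟩, hb⟩ := h
    have h₁ := hb.isConfig_inner hv hc
    have h₂ := hb.isConfig_outer hv hc
    have ha := isAcyclicNet_innerNet hv hb
    have hx := fun w => hc.mem v w
    simp only [Finset.coe_product, Set.mem_prod, Finset.coe_filter, Finset.mem_univ, true_and,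
      Set.mem_ofPred_eq, Finset.mem_coe]
    refine ⟨⟨⟨h₁, ha⟩, hb.addr_mem hc⟩, hx, ?_, h₂⟩
    rw [← hQ B hB _ _ _ h₁.toIsNetOn ha h₂.toIsNetOn hx, hb.glueNet_split hv hc.toIsNetOn]
    exact hq
  · rintro ⟨⟨⟨f₁, s₁⟩, y⟩, x, f₂, s₂⟩ h
    simp only [Finset.coe_product, Set.mem_prod, Finset.coe_filter, Finset.mem_univ, true_and,
      Set.mem_ofPred_eq, Finset.mem_coe] at h
    obtain ⟨⟨⟨h₁, ha⟩, hy⟩, hx, hr, h₂⟩ := h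
    simp only [Finset.coe_filter, Finset.mem_filter, Finset.mem_univ, true_and, hbas,
      Set.mem_ofPred_eq]
    exact ⟨⟨isConfig_glue hv hB h₁ ha h₂ hx hy,
      (hQ B hB _ _ _ h₁.toIsNetOn ha h₂.toIsNetOn hx).mpr hr⟩,
      isBasin_glue hv hB h₁.toIsNetOn ha h₂.toIsNetOn x⟩
  · rintro ⟨f, s⟩ h
    simp only [Finset.coe_filter, Finset.mem_filter, Finset.mem_univ, true_and, hbas,
      Set.mem_ofPred_eq] at h
    obtain ⟨⟨hc, hq⟩, hb⟩ := h
    simp only [hb.glueNet_split hv hc.toIsNetOn, glueAddr_split hc]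
  · rintro ⟨⟨⟨f₁, s₁⟩, y⟩, x, f₂, s₂⟩ h
    simp only [Finset.coe_product, Set.mem_prod, Finset.coe_filter, Finset.mem_univ, true_and,
      Set.mem_ofPred_eq, Finset.mem_coe] at h
    obtain ⟨⟨⟨h₁, ha⟩, hy⟩, hx, hr, h₂⟩ := h
    simp only [innerNet_glueNet hv hB h₁.toIsNetOn, restrictNet_glueNet hv h₂.toIsNetOn,
      restrictAddr_glueAddr_inner hv hB h₁, restrictAddr_glueAddr_outer hv h₂, glueNet_self]
    simp [glueAddr]

end Count
end Decomposition

theorem IsAcyclicNet.exists_eq_none {V : Type*} {S : Finset V} {f : V → Option V} (ha : IsAcyclicNet f) (hf : IsNetOn S f)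
    (hS : S.Nonempty) : ∃ r ∈ S, f r = none := by
  obtain ⟨u, hu⟩ := hS
  obtain ⟨r, hr, hmin⟩ := ha.has_min (s := (S : Set V)) ⟨u, hu⟩
  refine ⟨r, hr, ?_⟩
  cases e : f r with
  | none => rfl
  | some w => exact absurd e (hmin w (hf.mem _ _ e))

theorem isAcyclicNet_none {V : Type*} : IsAcyclicNet fun _ : V => (none : Option V) :=
  ⟨fun _ => ⟨_, fun _ h => by simp at h⟩⟩

/-! ### Recurrences for mappings, forests and trees -/

section Recurrences

variable {V : Type*} [LinearOrder V] {v : V} {S B : Finset V}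

/-- All nodes in `S` have an outgoing street. -/
def IsMappingNet (S : Finset V) (f : V → Option V) : Prop := ∀ u ∈ S, f u ≠ none

/-- The road net is acyclic and exactly one node in `S` has no outgoing street. -/
def IsTreeNet (S : Finset V) (f : V → Option V) : Prop :=
  IsAcyclicNet f ∧ ∃ r ∈ S, ∀ u ∈ S, f u = none ↔ u = r

theorem isMappingNet_glueNet_iff (hv : ∀ u ∈ S, u < v) (hB : B ⊆ S) {f₁ f₂ : V → Option V}
    {x : Option V} : IsMappingNet (insert v S) (glueNet v B x f₁ f₂) ↔
      x ≠ none ∧ IsMappingNet (S \ B) f₂ := by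
  unfold IsMappingNet
  rw [Finset.forall_mem_insert, glueNet_self]
  refine and_congr_right fun _ => ⟨fun h u hu => ?_, fun h u hu => ?_⟩
  · have hu' := Finset.mem_sdiff.mp hu
    rw [← glueNet_of_notMem hu'.2 (hv u hu'.1).ne x f₁ f₂]
    exact h u hu'.1
  · by_cases huB : u ∈ B
    · simp [glueNet_of_mem hv hB huB]
    · rw [glueNet_of_notMem huB (hv u hu).ne]
      exact h u (Finset.mem_sdiff.mpr ⟨hu, huB⟩)

/-- An exit of `v` into `B ∪ {v}` would close a cycle, since all these nodes lead to `v`.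
Conversely, accessibility is obtained on `S \ B`, then at `v`, then on `B`. -/
theorem isAcyclicNet_glueNet_iff (hv : ∀ u ∈ S, u < v) (hB : B ⊆ S) {f₁ f₂ : V → Option V}
    {x : Option V} (h₁ : IsNetOn B f₁) (ha : IsAcyclicNet f₁) (h₂ : IsNetOn (S \ B) f₂)
    (hx : ∀ w, x = some w → w ∈ insert v S) : IsAcyclicNet (glueNet v B x f₁ f₂) ↔
      (∀ w, x = some w → w ∈ S \ B) ∧ IsAcyclicNet f₂ := by
  constructor
  · intro h
    have hcyc : ∀ u w, ReachesBelow (glueNet v B x f₁ f₂) u w →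
        Relation.ReflTransGen (fun b a => glueNet v B x f₁ f₂ b = some a) u w := by
      intro u w hr
      induction hr with
      | refl => exact .refl
      | step _ e _ ih => exact .head e ih
    constructor
    · intro w hw
      by_contra hwC
      have hwA : w ∈ insert v B := by
        have := hx w hw
        simp only [Finset.mem_insert, Finset.mem_sdiff] at *
        tauto
      have hr : ReachesBelow (glueNet v B x f₁ f₂) w v := by
        rcases Finset.mem_insert.mp hwA with rfl | hwB
        · exact .refl _
        · exact glueNet_reaches_top hv hB h₁ ha x w hwB
      have ht : Relation.TransGen (fun b a => glueNet v B x f₁ f₂ b = some a) v v :=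
        .head' (by rw [glueNet_self, hw]) (hcyc _ _ hr)
      have := Relation.transGen_swap.mpr ht
      exact h.transGen.irrefl.irrefl v this
    · refine Subrelation.wf (r := fun w u => glueNet v B x f₁ f₂ u = some w) ?_ h
      intro w u e
      have hu := Finset.mem_sdiff.mp (h₂.mem_left e)
      change glueNet v B x f₁ f₂ u = some w
      rw [glueNet_of_notMem hu.2 (hv u hu.1).ne, e]
  · rintro ⟨hxC, h⟩
    have hC : ∀ u, u ∉ B → u ≠ v → Acc (fun w u => glueNet v B x f₁ f₂ u = some w) u := by
      intro u
      induction u using h.induction with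
      | _ u ih =>
        intro huB huv
        constructor
        intro w e
        rw [glueNet_of_notMem huB huv] at e
        have hw := Finset.mem_sdiff.mp (h₂.mem _ _ e)
        exact ih w e hw.2 (hv w hw.1).ne
    have hvacc : Acc (fun w u => glueNet v B x f₁ f₂ u = some w) v := by
      constructor
      intro w e
      rw [glueNet_self] at e
      have hw := Finset.mem_sdiff.mp (hxC w e)
      exact hC w hw.2 (hv w hw.1).ne
    have hBacc : ∀ u, u ∈ B → Acc (fun w u => glueNet v B x f₁ f₂ u = some w) u := by
      intro u
      induction u using ha.induction with
      | _ u ih =>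
        intro hu
        constructor
        intro w e
        rw [glueNet_of_mem hv hB hu] at e
        cases e₁ : f₁ u with
        | none =>
          rw [e₁] at e
          obtain rfl := Option.some.inj e
          exact hvacc
        | some w' =>
          rw [e₁] at e
          obtain rfl := Option.some.inj e
          exact ih _ e₁ (h₁.mem _ _ e₁)
    constructor
    intro u
    by_cases huv : u = v
    · exact huv ▸ hvacc
    · by_cases huB : u ∈ B
      · exact hBacc u huB
      · exact hC u huB huv

/-- Nodes of `B` have exits after gluing, so the root is `v` or lies in `S \ B`. A nonempty acyclic
outer part already contains a root, which forces `v` to exit into it. -/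
theorem isTreeNet_glueNet_iff (hv : ∀ u ∈ S, u < v) (hB : B ⊆ S) {f₁ f₂ : V → Option V}
    {x : Option V} (h₁ : IsNetOn B f₁) (ha : IsAcyclicNet f₁) (h₂ : IsNetOn (S \ B) f₂)
    (hx : ∀ w, x = some w → w ∈ insert v S) : IsTreeNet (insert v S) (glueNet v B x f₁ f₂) ↔
      if S \ B = ∅ then x = none ∧ IsAcyclicNet f₂
      else (∃ w ∈ S \ B, x = some w) ∧ IsTreeNet (S \ B) f₂ := by
  have hvS : v ∉ S := fun h => (hv v h).false
  have hglueB : ∀ u ∈ B, glueNet v B x f₁ f₂ u ≠ none := fun u hu => by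
    simp [glueNet_of_mem hv hB hu]
  have hglueC : ∀ u ∈ S \ B, glueNet v B x f₁ f₂ u = f₂ u := fun u hu =>
    glueNet_of_notMem (Finset.mem_sdiff.mp hu).2 (hv u (Finset.mem_sdiff.mp hu).1).ne _ _ _
  rw [IsTreeNet, isAcyclicNet_glueNet_iff hv hB h₁ ha h₂ hx]
  split_ifs with hC
  · have hBS : ∀ u ∈ S, u ∈ B := Finset.sdiff_eq_empty_iff_subset.mp hC
    constructor
    · rintro ⟨⟨h, h'⟩, -⟩
      refine ⟨?_, h'⟩
      cases x with
      | none => rfl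
      | some w => simpa [hC] using h w rfl
    · rintro ⟨rfl, h'⟩
      refine ⟨⟨by simp, h'⟩, v, by simp, fun u hu => ?_⟩
      rcases Finset.mem_insert.mp hu with rfl | hu
      · simp
      · exact iff_of_false (hglueB u (hBS u hu)) (hv u hu).ne
  · constructor
    · rintro ⟨⟨h, h'⟩, r, hr, hroot⟩
      obtain ⟨r', hr', e⟩ := h'.exists_eq_none h₂ (Finset.nonempty_iff_ne_empty.mpr hC)
      have hr'S := (Finset.mem_sdiff.mp hr').1
      obtain rfl : r' = r := (hroot r' (Finset.mem_insert_of_mem hr'S)).mp (by rw [hglueC r' hr', e])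
      have hxn : x ≠ none := fun hxn =>
        (hv r' hr'S).ne ((hroot v (by simp)).mp (by rw [glueNet_self, hxn])).symm
      obtain ⟨w, rfl⟩ := Option.ne_none_iff_exists'.mp hxn
      refine ⟨⟨w, h w rfl, rfl⟩, h', r', hr', fun u hu => ?_⟩
      rw [← hglueC u hu]
      exact hroot u (Finset.mem_insert_of_mem (Finset.mem_sdiff.mp hu).1)
    · rintro ⟨⟨w, hw, rfl⟩, h', r, hr, hroot⟩
      have hrS := (Finset.mem_sdiff.mp hr).1
      refine ⟨⟨fun w' e => Option.some.inj e ▸ hw, h'⟩, r, Finset.mem_insert_of_mem hrS,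
        fun u hu => ?_⟩
      rcases Finset.mem_insert.mp hu with rfl | hu
      · simp [(hv r hrS).ne']
      · by_cases huB : u ∈ B
        · refine iff_of_false (hglueB u huB) ?_
          rintro rfl
          exact (Finset.mem_sdiff.mp hr).2 huB
        · have huC := Finset.mem_sdiff.mpr ⟨hu, huB⟩
          rw [hglueC u huC]
          exact hroot u huC

variable [Fintype V]

open Classical in
theorem card_filter_config (C : Finset V) (X : Finset (Option V)) (Q : (V → Option V) → Prop)
    (P : Option V × ((V → Option V) × (V → V)) → Prop) [DecidablePred P]
    (hP : ∀ q, P q ↔ q.1 ∈ X ∧ IsConfig C q.2.1 q.2.2 ∧ Q q.2.1) :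
    (Finset.univ.filter P).card = X.card * configCount C Q := by
  rw [configCount, ← Finset.card_product]
  congr 1
  ext q
  simp [hP]

theorem configCount_empty (Q : (V → Option V) → Prop) (hQ : Q fun _ => none) :
    configCount ∅ Q = 1 := by
  classical
  rw [configCount, Finset.card_eq_one]
  refine ⟨(fun _ => none, id), ?_⟩
  ext ⟨f, s⟩
  simp only [Finset.mem_filter, Finset.mem_univ, true_and, Finset.mem_singleton, Prod.mk.injEq]
  constructor
  · rintro ⟨h, -⟩
    exact ⟨funext fun u => h.eq_none u (by simp), funext fun u => h.addr_eq u (by simp)⟩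
  · rintro ⟨rfl, rfl⟩
    exact ⟨⟨⟨by simp, by simp⟩, by simp, fun k => .refl k⟩, hQ⟩

theorem configCount_mapping_insert (hv : ∀ u ∈ S, u < v) :
    configCount (insert v S) (IsMappingNet (insert v S)) =
      ∑ B ∈ S.powerset, configCount B IsAcyclicNet * (B.card + 1) *
        ((S.card + 1) * configCount (S \ B) (IsMappingNet (S \ B))) := by
  classical
  rw [configCount_insert hv _ (fun C x f₂ => x ≠ none ∧ IsMappingNet C f₂)
    (fun B hB _ _ _ _ _ _ _ => isMappingNet_glueNet_iff hv hB)]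
  refine Finset.sum_congr rfl fun B hB => ?_
  rw [card_filter_config (S \ B) ((insert v S).map .some) (IsMappingNet (S \ B)),
    Finset.card_map, Finset.card_insert_of_notMem fun h => (hv v h).false]
  rintro ⟨x, f, s⟩
  cases x <;> simp
  tauto

theorem configCount_forest_insert (hv : ∀ u ∈ S, u < v) :
    configCount (insert v S) IsAcyclicNet =
      ∑ B ∈ S.powerset, configCount B IsAcyclicNet * (B.card + 1) *
        (((S \ B).card + 1) * configCount (S \ B) IsAcyclicNet) := by
  classical
  rw [configCount_insert hv _ (fun C x f₂ => (∀ w, x = some w → w ∈ C) ∧ IsAcyclicNet f₂)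
    (fun B hB _ _ _ h₁ ha h₂ hx => isAcyclicNet_glueNet_iff hv hB h₁ ha h₂ hx)]
  refine Finset.sum_congr rfl fun B hB => ?_
  rw [card_filter_config (S \ B) (Finset.insertNone (S \ B)) IsAcyclicNet,
    Finset.card_insertNone]
  rintro ⟨x, f, s⟩
  cases x <;> simp
  · tauto
  · tauto

theorem configCount_tree_insert (hv : ∀ u ∈ S, u < v) :
    configCount (insert v S) (IsTreeNet (insert v S)) =
      ∑ B ∈ S.powerset, configCount B IsAcyclicNet * (B.card + 1) *
        (if S \ B = ∅ then 1 else (S \ B).card * configCount (S \ B) (IsTreeNet (S \ B))) := by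
  classical
  rw [configCount_insert hv _ (fun C x f₂ => if C = ∅ then x = none ∧ IsAcyclicNet f₂
      else (∃ w ∈ C, x = some w) ∧ IsTreeNet C f₂)
    (fun B hB _ _ _ h₁ ha h₂ hx => isTreeNet_glueNet_iff hv hB h₁ ha h₂ hx)]
  refine Finset.sum_congr rfl fun B hB => ?_
  split_ifs with hC
  · rw [card_filter_config (S \ B) {none} IsAcyclicNet, hC,
      configCount_empty _ isAcyclicNet_none, Finset.card_singleton]
    rintro ⟨x, f, s⟩
    cases x <;> simp
    tauto
  · rw [card_filter_config (S \ B) ((S \ B).map .some) (IsTreeNet (S \ B)), Finset.card_map]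
    rintro ⟨x, f, s⟩
    cases x <;> simp
    tauto

end Recurrences

/-! ### Solving the recurrences -/

section ClosedForms

open Finset

/-- The binomial number of subsets of each size turns the subset sum into a product of exponential
generating functions. -/
theorem sum_powerset_card_sdiff {V : Type*} [DecidableEq V] (S : Finset V) (φ : ℕ → ℕ → ℚ) :
    ∑ B ∈ S.powerset, φ B.card (S \ B).card = (S.card.factorial : ℚ) *
      ∑ p ∈ antidiagonal S.card, φ p.1 p.2 / ((p.1.factorial : ℚ) * (p.2.factorial : ℚ)) := by
  have h : ∀ B ∈ S.powerset, φ B.card (S \ B).card = φ B.card (S.card - B.card) := fun B hB => by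
    rw [card_sdiff_of_subset (mem_powerset.mp hB)]
  rw [sum_congr rfl h, sum_powerset_apply_card fun k => φ k (S.card - k), mul_sum,
    Finset.Nat.sum_antidiagonal_eq_sum_range_succ_mk]
  refine sum_congr rfl fun k hk => ?_
  rw [nsmul_eq_mul, Nat.cast_choose ℚ (mem_range_succ_iff.mp hk)]
  ring

theorem sum_antidiagonal_antidiagonal (n : ℕ) (φ : ℕ → ℕ → ℕ → ℚ) :
    ∑ p ∈ antidiagonal n, ∑ q ∈ antidiagonal p.2, φ p.1 q.1 q.2 =
      ∑ p ∈ antidiagonal n, ∑ q ∈ antidiagonal p.1, φ q.1 q.2 p.2 := by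
  rw [sum_sigma', sum_sigma']
  refine sum_nbij' (fun x => ⟨(x.1.1 + x.2.1, x.2.2), (x.1.1, x.2.1)⟩)
    (fun x => ⟨(x.2.1, x.2.2 + x.1.2), (x.2.2, x.1.2)⟩) ?_ ?_ ?_ ?_ ?_
  · rintro ⟨⟨a, d⟩, b, c⟩ h
    simp only [mem_sigma, HasAntidiagonal.mem_antidiagonal] at h ⊢
    exact ⟨by change a + b + c = n; omega, trivial⟩
  · rintro ⟨⟨d, c⟩, a, b⟩ h
    simp only [mem_sigma, HasAntidiagonal.mem_antidiagonal] at h ⊢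
    exact ⟨by change a + (b + c) = n; omega, trivial⟩
  · rintro ⟨⟨a, d⟩, b, c⟩ h
    simp only [mem_sigma, HasAntidiagonal.mem_antidiagonal] at h
    obtain ⟨-, rfl⟩ := h
    rfl
  · rintro ⟨⟨d, c⟩, a, b⟩ h
    simp only [mem_sigma, HasAntidiagonal.mem_antidiagonal] at h
    obtain ⟨-, rfl⟩ := h
    rfl
  · intro x _
    rfl

/-- The number of parking configurations for forests with `k` nodes. -/
def forestValue (k : ℕ) : ℚ := (2 * ((k : ℚ) + 1)) ^ k / ((k : ℚ) + 1) ^ 2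

/-- The weight `k + 1`, coming from the address of the last driver or from the exit of `v`, turns
forest numbers into Abel values at 2. -/
theorem succ_mul_forestValue (k : ℕ) :
    ((k : ℚ) + 1) * forestValue k = (k.factorial : ℚ) * abel k 2 := by
  have h1 : (k : ℚ) + 1 ≠ 0 := by positivity
  have h0 : (k.factorial : ℚ) ≠ 0 := by exact_mod_cast Nat.factorial_ne_zero _
  rw [abel_of_add_eq (c := 2 * ((k : ℚ) + 1)) (by positivity) (by ring), forestValue]
  field_simp

/-- The forest recurrence convolves two Abel values at 2, so the argument must be 2 + 2. -/
theorem forestValue_succ (k : ℕ) : forestValue (k + 1) = (k.factorial : ℚ) * abel k 4 := by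
  have h1 : (k : ℚ) + 2 ≠ 0 := by positivity
  have h0 : (k.factorial : ℚ) ≠ 0 := by exact_mod_cast Nat.factorial_ne_zero _
  rw [abel_of_add_eq (c := 2 * ((k : ℚ) + 2)) (by positivity) (by ring), forestValue, pow_succ]
  push_cast
  rw [show (k : ℚ) + 1 + 1 = k + 2 by ring]
  field_simp
  ring

/-- The number of parking configurations for mappings of size `n`. -/
noncomputable def mappingValue (n : ℕ) : ℚ :=
  (n.factorial : ℚ) * ∑ p ∈ antidiagonal n, abel p.1 (2 * (p.2 : ℚ))

/-- Reassociating the triple convolution merges `abel a 2` with `abel b (2c)` into an Abel value at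
`2(c + 1)`, which shifts the second index by one. -/
theorem mappingValue_succ (n : ℕ) :
    mappingValue (n + 1) = (n.factorial : ℚ) * ∑ p ∈ antidiagonal n,
      ((n : ℚ) + 1) * abel p.1 2 * (mappingValue p.2 / (p.2.factorial : ℚ)) := by
  have h : ∀ k, mappingValue k / (k.factorial : ℚ) =
      ∑ p ∈ antidiagonal k, abel p.1 (2 * (p.2 : ℚ)) := fun k => by
    have h0 : (k.factorial : ℚ) ≠ 0 := by exact_mod_cast Nat.factorial_ne_zero _
    rw [mappingValue]; field_simp
  simp only [h, mul_assoc]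
  rw [← mul_sum, ← mul_assoc, mappingValue, Nat.factorial_succ, Nat.cast_mul,
    mul_comm ((n + 1 : ℕ) : ℚ), Nat.cast_add_one]
  congr 1
  simp only [mul_sum]
  rw [sum_antidiagonal_antidiagonal n fun a b c => abel a 2 * abel b (2 * (c : ℚ)),
    Finset.Nat.sum_antidiagonal_succ']
  -- The summand with second index 0 is the one not produced by the shift; it vanishes.
  simp only [Nat.cast_zero, mul_zero, abel_succ_zero, zero_add]
  refine sum_congr rfl fun p _ => ?_
  rw [sum_abel_mul_abel p.1 2 (2 * (p.2 : ℚ))]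
  push_cast
  congr 1
  ring

theorem factorial_mul_sum_abel (n : ℕ) (ψ : ℕ → ℚ) : (n.factorial : ℚ) *
    ∑ p ∈ antidiagonal n, abel p.1 2 * (ψ p.2 / (p.2.factorial : ℚ)) =
      (n.factorial : ℚ) * ∑ p ∈ antidiagonal n, (((p.1 : ℚ) + 1) * forestValue p.1 * ψ p.2) /
        ((p.1.factorial : ℚ) * (p.2.factorial : ℚ)) := by
  congr 1
  refine sum_congr rfl fun p _ => ?_
  have h0 : (p.1.factorial : ℚ) ≠ 0 := by exact_mod_cast Nat.factorial_ne_zero _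
  rw [succ_mul_forestValue]
  field_simp

theorem forestValue_succ_eq_sum_powerset {V : Type*} [DecidableEq V] (T : Finset V) :
    forestValue (T.card + 1) = ∑ B ∈ T.powerset, ((B.card : ℚ) + 1) * forestValue B.card *
      ((((T \ B).card : ℚ) + 1) * forestValue (T \ B).card) := by
  rw [sum_powerset_card_sdiff T fun a b =>
      ((a : ℚ) + 1) * forestValue a * (((b : ℚ) + 1) * forestValue b),
    ← factorial_mul_sum_abel _ fun b => ((b : ℚ) + 1) * forestValue b,
    forestValue_succ, show (4 : ℚ) = 2 + 2 by norm_num, ← sum_abel_mul_abel]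
  congr 1
  refine sum_congr rfl fun p _ => ?_
  have h0 : (p.2.factorial : ℚ) ≠ 0 := by exact_mod_cast Nat.factorial_ne_zero _
  rw [succ_mul_forestValue]
  field_simp

theorem mappingValue_succ_eq_sum_powerset {V : Type*} [DecidableEq V] (T : Finset V) :
    mappingValue (T.card + 1) = ∑ B ∈ T.powerset, ((B.card : ℚ) + 1) * forestValue B.card *
      (((T.card : ℚ) + 1) * mappingValue (T \ B).card) := by
  rw [sum_powerset_card_sdiff T fun a b =>
      ((a : ℚ) + 1) * forestValue a * (((T.card : ℚ) + 1) * mappingValue b),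
    ← factorial_mul_sum_abel _ fun b => ((T.card : ℚ) + 1) * mappingValue b, mappingValue_succ]
  congr 1
  refine sum_congr rfl fun p _ => ?_
  ring

theorem mappingValue_eq (n : ℕ) (hn : 1 ≤ n) :
    mappingValue n = ((n - 1).factorial : ℚ) *
      ∑ j ∈ range n, ((n : ℚ) - (j : ℚ)) * (2 * (n : ℚ)) ^ j / (j.factorial : ℚ) := by
  obtain ⟨n, rfl⟩ := Nat.exists_eq_add_of_le' hn
  rw [mappingValue, Finset.Nat.sum_antidiagonal_succ', Nat.cast_zero, mul_zero, abel_succ_zero,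
    zero_add, Finset.Nat.sum_antidiagonal_eq_sum_range_succ_mk, Nat.factorial_succ, Nat.cast_mul,
    mul_comm ((n + 1 : ℕ) : ℚ), mul_assoc, Nat.add_sub_cancel, mul_sum]
  congr 1
  refine sum_congr rfl fun j hj => ?_
  have hj' : j ≤ n := mem_range_succ_iff.mp hj
  have h1 : (n : ℚ) + 1 ≠ 0 := by positivity
  have h0 : (j.factorial : ℚ) ≠ 0 := by exact_mod_cast Nat.factorial_ne_zero _
  -- The argument `2(n + 1 - j)` plus `2j` is the same constant for every `j`.
  rw [abel_of_add_eq (c := 2 * ((n : ℚ) + 1)) (by positivity)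
    (by push_cast [Nat.cast_sub hj']; ring)]
  push_cast [Nat.cast_sub hj']
  field_simp
  ring

variable {V : Type*} [LinearOrder V]

theorem exists_eq_insert_max (S : Finset V) (hS : S.Nonempty) :
    ∃ v T, S = insert v T ∧ (∀ u ∈ T, u < v) ∧ S.card = T.card + 1 := by
  refine ⟨S.max' hS, S.erase (S.max' hS), (insert_erase (S.max'_mem hS)).symm, fun u hu => ?_,
    (card_erase_add_one (S.max'_mem hS)).symm⟩
  exact S.lt_max'_of_mem_erase_max' hS hu

theorem ssubset_insert_of_subset {v : V} {T B : Finset V} (hv : ∀ u ∈ T, u < v) (hB : B ⊆ T) :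
    B ⊂ insert v T :=
  hB.trans_ssubset (ssubset_insert fun h => (hv v h).false)

variable [Fintype V]

theorem configCount_forest (S : Finset V) :
    (configCount S IsAcyclicNet : ℚ) = forestValue S.card := by
  induction S using Finset.strongInduction with
  | H S ih =>
    rcases S.eq_empty_or_nonempty with rfl | hS
    · simp [configCount_empty _ isAcyclicNet_none, forestValue]
    obtain ⟨v, T, rfl, hv, hc⟩ := exists_eq_insert_max S hS
    rw [configCount_forest_insert hv, hc, forestValue_succ_eq_sum_powerset]
    push_cast
    refine sum_congr rfl fun B hB => ?_
    rw [mem_powerset] at hB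
    rw [ih B (ssubset_insert_of_subset hv hB),
      ih (T \ B) (ssubset_insert_of_subset hv sdiff_subset)]
    ring

theorem configCount_mapping (S : Finset V) :
    (configCount S (IsMappingNet S) : ℚ) = mappingValue S.card := by
  induction S using Finset.strongInduction with
  | H S ih =>
    rcases S.eq_empty_or_nonempty with rfl | hS
    · rw [configCount_empty _ fun u hu => absurd hu (notMem_empty u)]
      simp [mappingValue]
    obtain ⟨v, T, rfl, hv, hc⟩ := exists_eq_insert_max S hS
    rw [configCount_mapping_insert hv, hc, mappingValue_succ_eq_sum_powerset]
    push_cast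
    refine sum_congr rfl fun B hB => ?_
    rw [mem_powerset] at hB
    rw [configCount_forest, ih (T \ B) (ssubset_insert_of_subset hv sdiff_subset)]
    ring

/-- Multiplying the tree recurrence by the size gives the mapping recurrence: the exit of `v` has
`(S \ B).card` choices, just the factor that the induction hypothesis absorbs. -/
theorem card_mul_configCount_tree (S : Finset V) (hS : S.Nonempty) :
    (S.card : ℚ) * (configCount S (IsTreeNet S) : ℚ) = mappingValue S.card := by
  induction S using Finset.strongInduction with
  | H S ih =>
    obtain ⟨v, T, rfl, hv, hc⟩ := exists_eq_insert_max S hS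
    rw [configCount_tree_insert hv, hc, mappingValue_succ_eq_sum_powerset]
    push_cast
    rw [mul_sum]
    refine sum_congr rfl fun B hB => ?_
    rw [mem_powerset] at hB
    rw [configCount_forest]
    split_ifs with hC
    -- When `v` is the root, the value 1 matches `mappingValue 0 = 1`.
    · simp [hC, mappingValue]
      ring
    · rw [ih (T \ B) (ssubset_insert_of_subset hv sdiff_subset) (nonempty_iff_ne_empty.mpr hC)]
      ring

end ClosedForms

/-! ### Relabelling by the output-function -/

theorem IsOutput.unique {V : Type*} {m : ℕ} {next : V → Option V} {s π π' : Fin m → V}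
    (h : IsOutput next s π) (h' : IsOutput next s π') : π = π' := by
  suffices H : ∀ k, π k = π' k from funext H
  intro k
  induction k using WellFoundedLT.induction with
  | _ k ih =>
    obtain ⟨hne, t, ht, hlt⟩ := h k
    obtain ⟨hne', t', ht', hlt'⟩ := h' k
    rcases lt_trichotomy t t' with hlt₁ | rfl | hlt₁
    · obtain ⟨j, hj, e⟩ := hlt' t hlt₁ _ ht
      exact absurd ((ih j hj).trans e) (hne j hj)
    · exact Option.some.inj (ht.symm.trans ht')
    · obtain ⟨j, hj, e⟩ := hlt t' hlt₁ _ ht'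
      exact absurd ((ih j hj).symm.trans e) (hne' j hj)

theorem reachesBelow_iff_travel {V : Type*} [LinearOrder V] (f : V → Option V) (u k : V) :
    ReachesBelow f u k ↔
      ∃ t, travel f t u = some k ∧ ∀ i < t, ∀ w, travel f i u = some w → w < k := by
  constructor
  · intro h
    induction h with
    | refl k => exact ⟨0, rfl, by simp⟩
    | @step u w k huk e _ ih =>
      obtain ⟨t, ht, hlt⟩ := ih
      refine ⟨t + 1, by simp [travel, e, ht], fun i hi w' hw' => ?_⟩
      cases i with
      | zero =>
        obtain rfl := Option.some.inj hw'
        exact huk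
      | succ i =>
        simp only [travel, e, Option.bind_some] at hw'
        exact hlt i (by omega) w' hw'
  · rintro ⟨t, ht, hlt⟩
    induction t generalizing u with
    | zero =>
      obtain rfl := Option.some.inj ht
      exact .refl _
    | succ t ih =>
      cases e : f u with
      | none => simp [travel, e] at ht
      | some w =>
        simp only [travel, e, Option.bind_some] at ht
        refine .step (hlt 0 (by omega) u rfl) e (ih w ht fun i hi w' hw' => ?_)
        exact hlt (i + 1) (by omega) w' (by simp [travel, e, hw'])

/-- The road net obtained by relabelling the nodes. -/
def relabelNet {V W : Type*} (π : V ≃ W) (f : V → Option V) (u : W) : Option W :=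
  (f (π.symm u)).map π

theorem relabelNet_symm_relabelNet {V W : Type*} (π : V ≃ W) (f : W → Option W) :
    relabelNet π (relabelNet π.symm f) = f := by
  funext u
  simp [relabelNet]

theorem relabelNet_injective {V W : Type*} (π : V ≃ W) :
    Function.Injective (relabelNet (V := V) π) :=
  Function.LeftInverse.injective (g := relabelNet π.symm) (relabelNet_symm_relabelNet π.symm)

theorem travel_relabelNet {V W : Type*} (π : V ≃ W) (f : V → Option V) (t : ℕ) (u : V) :
    travel (relabelNet π f) t (π u) = (travel f t u).map π := by
  induction t generalizing u with
  | zero => rfl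
  | succ t ih =>
    cases e : f u with
    | none => simp [travel, relabelNet, e]
    | some w => simp [travel, relabelNet, e, ← ih]

/-- Pulled back along `π`, the nodes occupied before driver `k` are exactly those smaller than `k`.
-/
theorem isOutput_relabelNet_iff {n : ℕ} (π : Equiv.Perm (Fin n)) (f : Fin n → Option (Fin n))
    (s : Fin n → Fin n) : IsOutput (relabelNet π f) (fun k => π (s k)) π ↔
      ∀ k, ReachesBelow f (s k) k := by
  refine forall_congr' fun k => ?_
  rw [reachesBelow_iff_travel]
  have h : ∀ j < k, π j ≠ π k := fun j hj e => hj.ne (π.injective e)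
  rw [and_iff_right h]
  simp only [travel_relabelNet]
  refine exists_congr fun t => and_congr ?_ (forall₂_congr fun i _ => ?_)
  · simp
  · cases travel f i (s k) <;> simp

/-- Drivers who all park may be relabelled by the nodes at which they park. -/
theorem card_parking_eq {n : ℕ} (Q : (Fin n → Option (Fin n)) → Prop)
    (hQ : ∀ (π : Equiv.Perm (Fin n)) f, Q f → Q (relabelNet π f)) :
    Nat.card {p : (Fin n → Option (Fin n)) × (Fin n → Fin n) //
        Q p.1 ∧ IsParkingFunction p.1 p.2} =
      n.factorial * configCount (Finset.univ : Finset (Fin n)) Q := by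
  classical
  have hc : configCount (Finset.univ : Finset (Fin n)) Q =
      Nat.card {p : (Fin n → Option (Fin n)) × (Fin n → Fin n) //
        (∀ k, ReachesBelow p.1 (p.2 k) k) ∧ Q p.1} := by
    rw [configCount, Nat.card_eq_fintype_card, Fintype.card_subtype]
    congr 1
    ext p
    simp only [Finset.mem_filter, Finset.mem_univ, true_and]
    exact and_congr_left fun _ => ⟨fun h => h.reaches, fun h => ⟨⟨by simp, by simp⟩, by simp, h⟩⟩
  have hp : n.factorial = Nat.card (Equiv.Perm (Fin n)) := by
    rw [Nat.card_eq_fintype_card, Fintype.card_perm, Fintype.card_fin]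
  rw [hc, hp, ← Nat.card_prod]
  symm
  refine Nat.card_congr (Equiv.ofBijective (fun q => ⟨(relabelNet q.1 q.2.1.1,
    fun k => q.1 (q.2.1.2 k)), hQ _ _ q.2.2.2, q.1, (isOutput_relabelNet_iff _ _ _).mpr q.2.2.1⟩)
    ⟨?_, ?_⟩)
  · rintro ⟨π, ⟨f, s⟩, h, hq⟩ ⟨π', ⟨f', s'⟩, h', hq'⟩ e
    simp only [Subtype.mk.injEq, Prod.mk.injEq] at e
    obtain ⟨e₁, e₂⟩ := e
    have o := (isOutput_relabelNet_iff π f s).mpr h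
    have o' := (isOutput_relabelNet_iff π' f' s').mpr h'
    rw [← e₁, ← e₂] at o'
    -- The permutation is recovered from the relabelled pair as its only output-function.
    obtain rfl : π = π' := DFunLike.coe_injective (o.unique o')
    obtain rfl := relabelNet_injective π e₁
    obtain rfl : s = s' := funext fun k => π.injective (congrFun e₂ k)
    rfl
  · rintro ⟨⟨f, s⟩, hq, π, hπ⟩
    -- Drivers park at distinct nodes; as there are `n` of each, the output is a permutation.
    have hinj : Function.Injective π := by
      intro j k e
      rcases lt_trichotomy j k with h | h | h
      · exact absurd e ((hπ k).1 j h)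
      · exact h
      · exact absurd e.symm ((hπ j).1 k h)
    obtain ⟨σ, rfl⟩ : ∃ σ : Equiv.Perm (Fin n), ⇑σ = π :=
      ⟨Equiv.ofBijective π (Finite.injective_iff_bijective.mp hinj), rfl⟩
    have e₁ := relabelNet_symm_relabelNet σ f
    have e₂ : (fun k => σ (σ.symm (s k))) = s := by simp
    refine ⟨(σ, ⟨(relabelNet σ.symm f, fun k => σ.symm (s k)), ?_, hQ _ _ hq⟩), ?_⟩
    · rw [← isOutput_relabelNet_iff σ, e₁, e₂]
      exact hπ
    · simp only [Subtype.mk.injEq, Prod.mk.injEq]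
      exact ⟨e₁, e₂⟩

/-- Families of road nets may be replaced by their images among all road nets. -/
theorem card_parking_congr {τ V : Type*} {m : ℕ} (N : τ → V → Option V)
    (hN : Function.Injective N) (Q : (V → Option V) → Prop) (hQ : ∀ f, Q f ↔ ∃ T, N T = f) :
    Nat.card {p : τ × (Fin m → V) // IsParkingFunction (N p.1) p.2} =
      Nat.card {p : (V → Option V) × (Fin m → V) // Q p.1 ∧ IsParkingFunction p.1 p.2} := by
  refine Nat.card_congr (Equiv.ofBijective
    (fun p => ⟨(N p.1.1, p.1.2), (hQ _).mpr ⟨_, rfl⟩, p.2⟩) ⟨?_, ?_⟩)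
  · rintro ⟨⟨T, s⟩, h⟩ ⟨⟨T', s'⟩, h'⟩ e
    simp only [Subtype.mk.injEq, Prod.mk.injEq] at e
    obtain rfl := hN e.1
    obtain rfl := e.2
    rfl
  · rintro ⟨⟨f, s⟩, hq, h⟩
    obtain ⟨T, rfl⟩ := (hQ f).mp hq
    exact ⟨⟨(T, s), h⟩, rfl⟩

theorem numMappingParking_eq (n : ℕ) : (numMappingParking n n : ℚ) =
    (n.factorial : ℚ) * mappingValue n := by
  have h := card_parking_congr (m := n) (fun (f : Fin n → Fin n) v => some (f v))
    (fun f g e => funext fun v => Option.some.inj (congrFun e v))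
    (IsMappingNet (Finset.univ : Finset (Fin n))) fun f => by
      constructor
      · intro h
        choose g hg using fun u => Option.ne_none_iff_exists'.mp (h u (Finset.mem_univ u))
        exact ⟨g, funext fun u => (hg u).symm⟩
      · rintro ⟨g, rfl⟩ u -
        simp
  rw [numMappingParking, h, card_parking_eq, Nat.cast_mul, configCount_mapping, Finset.card_fin]
  intro π f hf u _
  simpa [relabelNet] using hf (π.symm u) (Finset.mem_univ _)

theorem IsTreeNet.relabelNet {n : ℕ} (π : Equiv.Perm (Fin n)) {f : Fin n → Option (Fin n)}
    (hf : IsTreeNet Finset.univ f) : IsTreeNet Finset.univ (relabelNet π f) := by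
  obtain ⟨ha, r, -, hr⟩ := hf
  refine ⟨?_, π r, Finset.mem_univ _, fun u _ => ?_⟩
  · refine Subrelation.wf (r := InvImage (fun w u => f u = some w) π.symm) ?_ (InvImage.wf _ ha)
    intro w u e
    simp only [TreeParking.relabelNet, Option.map_eq_some_iff] at e
    obtain ⟨w', e, rfl⟩ := e
    simpa [InvImage] using e
  · simp only [TreeParking.relabelNet, Option.map_eq_none_iff]
    rw [hr _ (Finset.mem_univ _), Equiv.symm_apply_eq]

/-! ### Rooted labelled trees as road nets -/

section Trees

variable {V : Type*}

theorem RootedLabelledTree.isPath_pathToRoot (T : RootedLabelledTree V) (v : V) :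
    (T.pathToRoot v).IsPath :=
  (T.isTree.existsUnique_path v T.root).choose_spec.1

theorem RootedLabelledTree.eq_pathToRoot (T : RootedLabelledTree V) {v : V}
    (p : T.graph.Walk v T.root) (hp : p.IsPath) : p = T.pathToRoot v :=
  (T.isTree.existsUnique_path v T.root).choose_spec.2 p hp

theorem RootedLabelledTree.next_eq_none_iff (T : RootedLabelledTree V) (v : V) :
    T.next v = none ↔ v = T.root := by
  simp [RootedLabelledTree.next]

theorem RootedLabelledTree.next_eq_some (T : RootedLabelledTree V) {u w : V}
    (h : T.next u = some w) : ¬ (T.pathToRoot u).Nil ∧ (T.pathToRoot u).snd = w := by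
  unfold RootedLabelledTree.next at h
  split_ifs at h with hu
  exact ⟨fun hn => hu hn.eq, Option.some.inj h⟩

theorem RootedLabelledTree.adj_of_next (T : RootedLabelledTree V) {u w : V}
    (h : T.next u = some w) : T.graph.Adj u w := by
  obtain ⟨hn, rfl⟩ := T.next_eq_some h
  exact (T.pathToRoot u).adj_snd hn

theorem RootedLabelledTree.length_pathToRoot_lt (T : RootedLabelledTree V) {u w : V}
    (h : T.next u = some w) : (T.pathToRoot w).length < (T.pathToRoot u).length := by
  obtain ⟨hn, rfl⟩ := T.next_eq_some h
  rw [← T.eq_pathToRoot _ (T.isPath_pathToRoot u).tail]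
  have := SimpleGraph.Walk.length_tail_add_one hn
  omega

theorem RootedLabelledTree.isAcyclicNet_next (T : RootedLabelledTree V) : IsAcyclicNet T.next :=
  Subrelation.wf (r := InvImage (· < ·) fun u => (T.pathToRoot u).length)
    (fun h => T.length_pathToRoot_lt h) (InvImage.wf _ wellFounded_lt)

theorem RootedLabelledTree.next_eq_some_of_path (T : RootedLabelledTree V) {u w : V}
    (h : T.graph.Adj u w) (p : T.graph.Walk w T.root) (hp : (SimpleGraph.Walk.cons h p).IsPath) :
    T.next u = some w := by
  have e := T.eq_pathToRoot _ hp
  have hu : u ≠ T.root := by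
    rintro rfl
    rw [SimpleGraph.Walk.cons_isPath_iff] at hp
    exact hp.2 p.end_mem_support
  simp [RootedLabelledTree.next, hu, ← e]

/-- If `u` lies on the path from `w` to the root, uniqueness of paths makes the edge its first step;
otherwise the edge can be put in front of that path. -/
theorem RootedLabelledTree.adj_iff_next (T : RootedLabelledTree V) {u w : V} :
    T.graph.Adj u w ↔ T.next u = some w ∨ T.next w = some u := by
  classical
  refine ⟨fun h => ?_, fun h => h.elim T.adj_of_next fun h => (T.adj_of_next h).symm⟩
  have hp := T.isPath_pathToRoot w
  by_cases hu : u ∈ (T.pathToRoot w).support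
  · right
    refine T.next_eq_some_of_path h.symm ((T.pathToRoot w).dropUntil u hu) ?_
    have e : (T.pathToRoot w).takeUntil u hu = .cons h.symm .nil := by
      refine (T.isTree.existsUnique_path w u).unique (hp.takeUntil hu) ?_
      simp [h.ne']
    have e' := (T.pathToRoot w).take_spec hu
    rw [e] at e'
    rw [← e'] at hp
    exact hp
  · left
    exact T.next_eq_some_of_path h _ (hp.cons hu)

theorem RootedLabelledTree.next_injective :
    Function.Injective (RootedLabelledTree.next (V := V)) := by
  rintro T T' e
  have hr : T.root = T'.root := by
    rw [← T'.next_eq_none_iff, ← e, T.next_eq_none_iff]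
  have hg : T.graph = T'.graph := by
    ext u w
    rw [T.adj_iff_next, T'.adj_iff_next, e]
  cases T
  cases T'
  simp only at hr hg
  subst hr hg
  rfl

/-- The undirected graph of a road net. -/
def netGraph (f : V → Option V) : SimpleGraph V :=
  SimpleGraph.fromRel fun u w => f u = some w

theorem IsAcyclicNet.ne {f : V → Option V} (ha : IsAcyclicNet f) {u w : V} (h : f u = some w) :
    u ≠ w := by
  rintro rfl
  exact ha.irrefl.irrefl u h

theorem IsAcyclicNet.netGraph_adj {f : V → Option V} (ha : IsAcyclicNet f) {u w : V} :
    (netGraph f).Adj u w ↔ f u = some w ∨ f w = some u := by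
  rw [netGraph, SimpleGraph.fromRel_adj]
  exact and_iff_right_of_imp fun h => h.elim (fun h => ha.ne h) fun h => (ha.ne h).symm

/-- Following the streets connects every node to `r`. Each edge is the street of some node other
than `r`, so there are few enough edges for a tree. -/
theorem isTree_netGraph [Fintype V] {f : V → Option V} (ha : IsAcyclicNet f) {r : V}
    (hr : ∀ u, f u = none ↔ u = r) : (netGraph f).IsTree := by
  classical
  have hreach : ∀ u, (netGraph f).Reachable u r := by
    intro u
    induction u using ha.induction with
    | _ u ih =>
      cases e : f u with
      | none => rw [(hr u).mp e]
      | some w =>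
        exact (SimpleGraph.Adj.reachable (ha.netGraph_adj.mpr (.inl e))).trans (ih w e)
  have hconn : (netGraph f).Connected :=
    { preconnected := fun u w => (hreach u).trans (hreach w).symm
      nonempty := ⟨r⟩ }
  refine (SimpleGraph.isTree_iff_connected_and_card).mpr ⟨hconn, ?_⟩
  have hle := hconn.card_vert_le_card_edgeSet_add_one
  have hsub : (netGraph f).edgeSet ⊆
      ((Finset.univ.erase r).image fun u => s(u, (f u).getD u) : Finset (Sym2 V)) := by
    intro e
    induction e using Sym2.ind with
    | _ u w =>
      intro h
      rw [SimpleGraph.mem_edgeSet, ha.netGraph_adj] at h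
      rw [Finset.mem_coe, Finset.mem_image]
      rcases h with h | h
      · refine ⟨u, ?_, by simp [h]⟩
        simp [← hr, h]
      · refine ⟨w, ?_, by simp [h, Sym2.eq_swap]⟩
        simp [← hr, h]
  have h₁ := Set.ncard_le_ncard hsub (Finset.finite_toSet _)
  rw [Set.ncard_coe_finset] at h₁
  have h₂ := h₁.trans Finset.card_image_le
  rw [Finset.card_erase_of_mem (Finset.mem_univ r), Finset.card_univ,
    ← Nat.card_eq_fintype_card, ← Nat.card_coe_set_eq] at h₂
  have : 0 < Nat.card V := Nat.card_pos_iff.mpr ⟨⟨r⟩, inferInstance⟩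
  omega

theorem isTreeNet_iff_exists_tree [Fintype V] (f : V → Option V) :
    IsTreeNet Finset.univ f ↔ ∃ T : RootedLabelledTree V, T.next = f := by
  constructor
  · rintro ⟨ha, r, -, hr⟩
    have hr' : ∀ u, f u = none ↔ u = r := fun u => hr u (Finset.mem_univ u)
    let T : RootedLabelledTree V := ⟨netGraph f, isTree_netGraph ha hr', r⟩
    refine ⟨T, funext fun u => ?_⟩
    induction u using ha.induction with
    | _ u ih =>
      cases e : f u with
      | none =>
        rw [T.next_eq_none_iff]
        exact (hr' u).mp e
      | some w =>
        have hadj : T.graph.Adj u w := ha.netGraph_adj.mpr (.inl e)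
        -- If the edge pointed from `w` to `u` in `T`, the induction hypothesis at `w` would give a
        -- 2-cycle of `f`.
        refine (T.adj_iff_next.mp hadj).resolve_right fun h => ?_
        rw [ih w e] at h
        exact ha.asymmetric _ _ h e
  · rintro ⟨T, rfl⟩
    exact ⟨T.isAcyclicNet_next, T.root, Finset.mem_univ _, fun u _ => T.next_eq_none_iff u⟩

end Trees

theorem numTreeParking_eq (n : ℕ) : (numTreeParking n n : ℚ) =
    (n.factorial : ℚ) * (configCount (Finset.univ : Finset (Fin n)) (IsTreeNet Finset.univ) : ℚ) := by
  rw [numTreeParking, card_parking_congr _ RootedLabelledTree.next_injective _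
    isTreeNet_iff_exists_tree, card_parking_eq _ fun π f => IsTreeNet.relabelNet π, Nat.cast_mul]

end TreeParking

theorem mainTheorem6 (n : ℕ) (hn : 1 ≤ n) :
    (TreeParking.numMappingParking n n : ℚ) =
        (Nat.factorial n : ℚ) * (Nat.factorial (n - 1) : ℚ) *
          ∑ j ∈ Finset.range n,
            ((n : ℚ) - (j : ℚ)) * (2 * (n : ℚ)) ^ j / (Nat.factorial j : ℚ) ∧
      (TreeParking.numTreeParking n n : ℚ) =
        (Nat.factorial (n - 1) : ℚ) ^ 2 *
          ∑ j ∈ Finset.range n,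
            ((n : ℚ) - (j : ℚ)) * (2 * (n : ℚ)) ^ j / (Nat.factorial j : ℚ) := by
  constructor
  · rw [TreeParking.numMappingParking_eq, TreeParking.mappingValue_eq n hn, mul_assoc]
  · have : Nonempty (Fin n) := ⟨⟨0, hn⟩⟩
    have h := TreeParking.card_mul_configCount_tree (Finset.univ : Finset (Fin n))
      Finset.univ_nonempty
    rw [Finset.card_fin, TreeParking.mappingValue_eq n hn] at h
    -- The factor `n` split off from `n!` is the one needed to pass from trees to mappings.
    rw [TreeParking.numTreeParking_eq, ← Nat.mul_factorial_pred (by omega), Nat.cast_mul,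
      mul_right_comm, h]
    ring
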